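/- Let $0\le k\le n$. For a partition $\mu=(\mu_1\ge\mu_2\ge\cdots\ge\mu_\ell)$ of $n$ let $\chi^\mu$ be the irreducible complex character of the symmetric group $S_n$ indexed by $\mu$. For $i\ge 1$ and $\sigma\in S_n$ let $m_i(\sigma)$ be the number of cycles of length $i$ of $\sigma$ (fixed points being cycles of length $1$), and let $$m_\mu:=\prod_{i=2}^{\ell} m_{\mu_i},$$ a complex-valued function on $S_n$ (the largest part $\mu_1$ is omitted; an empty product is $1$; for the empty partition put $\mu_1=0$). Then: 1. For every partition $\nu$ of $k$ all of whose parts are at most $n-k$, let $(n-k,\nu)$ be the partition of $n$ obtained by adjoining the part $n-k$ to $\nu$ (no part being adjoined if $n-k=0$). There is exactly one family of complex coefficients $(c_\mu)$, indexed by the partitions $\mu$ of $n$ with $\mu_1\ge n-k$, such that $$\chi^{(n-k,\nu)}=\sum_{\mu\vdash n,\ \mu_1\ge n-k} c_\mu\, m_\mu .$$ 2. The family $(m_\mu)_{\mu\vdash n,\ \mu_1\ge n-k}$ is linearly independent over $\mathbb{C}$, and it has the same linear span as $\{\chi^\mu : \mu\vdash n,\ \mu_1\ge n-k\}$. 3.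 In particular, if $k\le n/2$, then $m_1,\dots,m_k$ are linearly independent over $\mathbb{C}$, as functions on $S_n$. -/

import Mathlib

noncomputable section

namespace SymChar

/-- The parts of a partition, listed in nonincreasing order. -/
def rows {n : ℕ} (μ : n.Partition) : List ℕ :=
  μ.parts.sort (· ≥ ·)

/-- The largest part `μ₁` of a partition (`0` for the empty partition). -/
def firstPart {n : ℕ} (μ : n.Partition) : ℕ :=
  (rows μ).headD 0

/-- The partition `(n - k, ν)` of `n`: the union of the part `n - k` with the parts of `ν ⊢ k`
(the part `n - k` is omitted if it is zero). -/
def adjoinPart {n k : ℕ} (hk : k ≤ n) (ν : k.Partition) : n.Partition :=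
  Nat.Partition.ofSums n ((n - k) ::ₘ ν.parts)
    (by rw [Multiset.sum_cons, ν.parts_sum]; exact Nat.sub_add_cancel hk)

/-! ### Cycle counting functions -/

/-- `m_i`: the number of cycles of length `i` of a permutation (fixed points are the cycles of
length `1`), as a complex valued function on the symmetric group. -/
def cycleCount (n i : ℕ) : Equiv.Perm (Fin n) → ℂ :=
  fun σ => (σ.partition.parts.count i : ℂ)

/-- `m_μ = ∏_{i ≥ 2} m_{μ_i}`: the product runs over all parts of `μ` but the first (largest)
one. -/
def cycleCountProd {n : ℕ} (μ : n.Partition) : Equiv.Perm (Fin n) → ℂ :=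
  (((rows μ).tail).map (cycleCount n)).prod

/-! ### Irreducible characters of the symmetric group, through Young symmetrizers -/

theorem sum_rows {n : ℕ} (μ : n.Partition) :
    ∑ i : Fin (rows μ).length, (rows μ).get i = n := by
  have h : (rows μ).sum = n := by
    rw [← Multiset.sum_coe, rows, Multiset.sort_eq, μ.parts_sum]
  rw [← List.sum_ofFn, List.ofFn_get, h]

/-- The cells of the Young diagram of `μ`: pairs of a row `i` and a column `j < μ_i`. -/
abbrev Cell {n : ℕ} (μ : n.Partition) : Type :=
  (i : Fin (rows μ).length) × Fin ((rows μ).get i)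

/-- The Young tableau of shape `μ` filled with `0, …, n - 1` along the rows, from top to bottom:
it sends an entry to its cell. -/
def tableau {n : ℕ} (μ : n.Partition) : Fin n ≃ Cell μ :=
  (finCongr (sum_rows μ).symm).trans finSigmaFinEquiv.symm

/-- The row of the tableau in which an entry stands. -/
def rowOf {n : ℕ} (μ : n.Partition) (a : Fin n) : ℕ := (tableau μ a).1

/-- The column of the tableau in which an entry stands. -/
def colOf {n : ℕ} (μ : n.Partition) (a : Fin n) : ℕ := (tableau μ a).2

open scoped Classical in
/-- The permutations that preserve every row of the tableau. -/
def rowGroup {n : ℕ} (μ : n.Partition) : Finset (Equiv.Perm (Fin n)) :=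
  Finset.univ.filter fun σ => ∀ a, rowOf μ (σ a) = rowOf μ a

open scoped Classical in
/-- The permutations that preserve every column of the tableau. -/
def colGroup {n : ℕ} (μ : n.Partition) : Finset (Equiv.Perm (Fin n)) :=
  Finset.univ.filter fun σ => ∀ a, colOf μ (σ a) = colOf μ a

/-- The Young symmetrizer `(∑ p) * (∑ sgn(q) q)` in the group algebra `ℂ[S_n]`, where `p` runs
over the row group and `q` over the column group. -/
def youngSymmetrizer {n : ℕ} (μ : n.Partition) : MonoidAlgebra ℂ (Equiv.Perm (Fin n)) :=
  (∑ p ∈ rowGroup μ, MonoidAlgebra.of ℂ (Equiv.Perm (Fin n)) p) *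
    ∑ q ∈ colGroup μ,
      ((Equiv.Perm.sign q : ℤ) : ℂ) • MonoidAlgebra.of ℂ (Equiv.Perm (Fin n)) q

/-- The Specht module of `μ`: the left ideal of `ℂ[S_n]` generated by the Young symmetrizer. -/
abbrev Specht {n : ℕ} (μ : n.Partition) : Ideal (MonoidAlgebra ℂ (Equiv.Perm (Fin n))) :=
  Ideal.span {youngSymmetrizer μ}

/-- The irreducible representation of `S_n` indexed by `μ`: left multiplication on the Specht
module. -/
def spechtRep {n : ℕ} (μ : n.Partition) :
    Representation ℂ (Equiv.Perm (Fin n)) (Specht μ) :=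
  Representation.ofModule' (Specht μ)

/-- The irreducible character `χ^μ` of `S_n` indexed by the partition `μ`. -/
def chi {n : ℕ} (μ : n.Partition) : Equiv.Perm (Fin n) → ℂ :=
  (spechtRep μ).character

end SymChar

end

noncomputable section

namespace SymChar

/-! ### Rows of a partition -/

/-! Both families have the same index set and are independent, so their spans coincide once one
inclusion is known. The other parts then follow.

Independence uses triangular matrices. For the `m_μ`, replace the product by `injCount`, a
combination of the same products. At a permutation of cycle type `ν` it is nonzero only if `μ`
without `μ₁` is contained in `ν`, which forces `ν = μ` or more parts (`eq_or_card_lt_of_tail_le`).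
For the `χ^μ`, evaluate at an idempotent generator `e_ν` of the Specht ideal. This gives the trace
of `e_ν` on the Specht module of `μ`, which is nonzero for `ν = μ` and vanishes unless `ν` dominates
`μ` (`colSum_mul_mul_rowSum_eq_zero`). Class functions have dimension at most the number of
partitions, so the characters span them; neither irreducibility nor orthogonality is needed.

For the inclusion, `m_μ` is a combination of indicators that prescribe at most `n - μ₁` values. If
`ν₁ < μ₁`, two of the remaining points share a column of `ν`, so the signed column sum, hence `e_ν`,
kills `m_μ`. By triangularity no `χ^ν` with `ν₁ < n - k` occurs in `m_μ` when `μ₁ ≥ n - k`. -/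

theorem coe_rows {n : ℕ} (μ : n.Partition) : (rows μ : Multiset ℕ) = μ.parts := by
  rw [rows, Multiset.sort_eq]

theorem rows_pairwise {n : ℕ} (μ : n.Partition) : (rows μ).Pairwise (· ≥ ·) :=
  Multiset.pairwise_sort _ _

theorem rows_injective {n : ℕ} : Function.Injective (rows : n.Partition → List ℕ) := by
  intro μ ν h
  apply Nat.Partition.ext
  rw [← coe_rows, ← coe_rows, h]

theorem sum_rows_list {n : ℕ} (μ : n.Partition) : (rows μ).sum = n := by
  rw [← Multiset.sum_coe, coe_rows, μ.parts_sum]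

theorem pos_of_mem_rows {n : ℕ} (μ : n.Partition) {i : ℕ} (hi : i ∈ rows μ) : 0 < i :=
  μ.parts_pos (by rw [← coe_rows]; exact hi)

theorem exists_rows_eq {n : ℕ} (l : List ℕ) (hl : l.Pairwise (· ≥ ·)) (hpos : ∀ i ∈ l, 0 < i)
    (hsum : l.sum = n) : ∃ μ : n.Partition, rows μ = l := by
  refine ⟨⟨l, fun hi => hpos _ hi, by simpa using hsum⟩, ?_⟩
  refine List.Perm.eq_of_pairwise' (rows_pairwise _) hl ?_
  rw [← Multiset.coe_eq_coe, coe_rows]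

theorem firstPart_add_tail {n : ℕ} (μ : n.Partition) : firstPart μ + (rows μ).tail.sum = n := by
  have h := sum_rows_list μ
  unfold firstPart
  cases hr : rows μ with
  | nil => simpa [hr] using h
  | cons a l => simpa [hr] using h

theorem le_firstPart {n : ℕ} (μ : n.Partition) {i : ℕ} (hi : i ∈ μ.parts) : i ≤ firstPart μ := by
  rw [← coe_rows, Multiset.mem_coe] at hi
  have h := rows_pairwise μ
  unfold firstPart
  cases hr : rows μ with
  | nil => simp [hr] at hi
  | cons a l =>
    rw [hr] at hi h
    rcases List.mem_cons.1 hi with rfl | hi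
    · simp
    · exact (List.pairwise_cons.1 h).1 _ hi

/-! ### Triangular families -/

/-- A family of vectors with a triangular matrix of values on a family of functionals: on a
saturated set of indices, the coefficients of a combination killed by the functionals vanish. -/
theorem coeff_eq_zero_of_triangular {ι V : Type*} [Fintype ι] [AddCommGroup V] [Module ℂ V]
    (L : ι → V →ₗ[ℂ] ℂ) (v : ι → V) (Φ : ι → ℕ) (hdiag : ∀ i, L i (v i) ≠ 0)
    (hoff : ∀ i j, L i (v j) ≠ 0 → i = j ∨ Φ j < Φ i) (P : ι → Prop)
    (hP : ∀ i j, P i → L i (v j) ≠ 0 → P j) (c : ι → ℂ)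
    (hc : ∀ i, P i → L i (∑ j, c j • v j) = 0) : ∀ i, P i → c i = 0 := by
  suffices H : ∀ m i, Φ i = m → P i → c i = 0 from fun i hi => H _ i rfl hi
  intro m
  induction m using Nat.strong_induction_on with
  | _ m ih =>
    intro i him hi
    have h := hc i hi
    rw [map_sum, Finset.sum_eq_single i] at h
    · simpa [hdiag i] using h
    · intro j _ hji
      rw [map_smul, smul_eq_mul]
      by_cases hL : L i (v j) = 0
      · rw [hL, mul_zero]
      · rcases hoff i j hL with rfl | hlt
        · exact absurd rfl hji
        · rw [ih _ (him ▸ hlt) j rfl (hP i j hi hL), zero_mul]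
    · simp

theorem linearIndependent_of_triangular {ι V : Type*} [Fintype ι] [AddCommGroup V] [Module ℂ V]
    (L : ι → V →ₗ[ℂ] ℂ) (v : ι → V) (Φ : ι → ℕ) (hdiag : ∀ i, L i (v i) ≠ 0)
    (hoff : ∀ i j, L i (v j) ≠ 0 → i = j ∨ Φ j < Φ i) : LinearIndependent ℂ v := by
  rw [Fintype.linearIndependent_iff]
  intro c hc i
  exact coeff_eq_zero_of_triangular L v Φ hdiag hoff (fun _ => True) (fun _ _ _ _ => trivial) c
    (fun _ _ => by rw [hc, map_zero]) i trivial

/-! ### Linear independence of the cycle counting products -/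

/-- The number of ways to choose distinct cycles with the given list of lengths. -/
def injCount (n : ℕ) : List ℕ → Equiv.Perm (Fin n) → ℂ
  | [] => 1
  | a :: l => (cycleCount n a - (l.count a : ℂ) • 1) * injCount n l

theorem injCount_mem_span (n : ℕ) (l : List ℕ) :
    injCount n l ∈ Submodule.span ℂ {f | ∃ l' : List ℕ, l'.Sublist l ∧ (l'.map (cycleCount n)).prod = f} := by
  induction l with
  | nil => exact Submodule.subset_span ⟨[], List.Sublist.refl _, rfl⟩
  | cons a l ih =>
    have hle : Submodule.span ℂ {f | ∃ l' : List ℕ, l'.Sublist l ∧ (l'.map (cycleCount n)).prod = f} ≤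
        Submodule.span ℂ {f | ∃ l' : List ℕ, l'.Sublist (a :: l) ∧ (l'.map (cycleCount n)).prod = f} :=
      Submodule.span_mono fun f ⟨l', h, hf⟩ => ⟨l', h.cons a, hf⟩
    rw [injCount, sub_mul, smul_mul_assoc, one_mul]
    refine Submodule.sub_mem _ ?_ (Submodule.smul_mem _ _ (hle ih))
    refine Submodule.span_induction (p := fun f _ => cycleCount n a * f ∈ _) ?_ ?_ ?_ ?_ ih
    · rintro f ⟨l', h, rfl⟩
      exact Submodule.subset_span ⟨a :: l', h.cons_cons a, by simp⟩
    · simp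
    · intro x y _ _ hx hy
      rw [mul_add]
      exact Submodule.add_mem _ hx hy
    · intro r x _ hx
      rw [mul_smul_comm]
      exact Submodule.smul_mem _ _ hx

/-- The factor for `a` vanishes exactly when the later entries of the list already use up all cycles
of length `a`. -/
theorem injCount_ne_zero_iff {n : ℕ} (l : List ℕ) (σ : Equiv.Perm (Fin n)) :
    injCount n l σ ≠ 0 ↔ (l : Multiset ℕ) ≤ σ.partition.parts := by
  induction l with
  | nil => simp [injCount]
  | cons a l ih =>
    have h1 : injCount n (a :: l) σ
        = ((σ.partition.parts.count a : ℂ) - (l.count a : ℂ)) * injCount n l σ := by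
      simp [injCount, cycleCount]
    rw [h1, mul_ne_zero_iff, ih, sub_ne_zero, Nat.cast_injective.ne_iff]
    simp only [Multiset.le_iff_count, Multiset.coe_count]
    constructor
    · rintro ⟨h2, h3⟩ b
      have := h3 b
      rw [List.count_cons]
      split_ifs with hb
      · have hb := eq_of_beq hb
        subst hb
        omega
      · exact this
    · intro h
      refine ⟨?_, fun b => ?_⟩
      · have := h a
        rw [List.count_cons_self] at this
        omega
      · refine le_trans ?_ (h b)
        rw [List.count_cons]
        omega

/-- `cycleType` records only lengths at least `2`; the parts equal to `1` reappear as fixed points.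
-/
theorem exists_perm_partition {n : ℕ} (μ : n.Partition) :
    ∃ σ : Equiv.Perm (Fin n), σ.partition.parts = μ.parts := by
  have hle : (μ.parts.filter (2 ≤ ·)).sum + (μ.parts.filter (¬ 2 ≤ ·)).sum = n := by
    rw [← Multiset.sum_add, Multiset.filter_add_not, μ.parts_sum]
  have hone : μ.parts.filter (¬ 2 ≤ ·) =
      Multiset.replicate (Multiset.card (μ.parts.filter (¬ 2 ≤ ·))) 1 := by
    rw [Multiset.eq_replicate]
    refine ⟨rfl, fun b hb => ?_⟩
    rw [Multiset.mem_filter] at hb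
    have := μ.parts_pos hb.1
    omega
  obtain ⟨σ, hσ⟩ := (Equiv.Perm.exists_with_cycleType_iff (α := Fin n)
    (m := μ.parts.filter (2 ≤ ·))).2
      ⟨by rw [Fintype.card_fin]; omega, fun a ha => (Multiset.mem_filter.1 ha).2⟩
  refine ⟨σ, ?_⟩
  rw [Equiv.Perm.parts_partition, ← Equiv.Perm.sum_cycleType, hσ, Fintype.card_fin]
  conv_rhs => rw [← Multiset.filter_add_not (2 ≤ ·) μ.parts, hone]
  congr 2
  have h2 := congrArg Multiset.sum hone
  rw [Multiset.sum_replicate, smul_eq_mul, mul_one] at h2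
  omega

/-- The parts of `ν` outside the tail of `μ` sum to `μ₁`. If there is only one, it is `μ₁` and `ν =
μ`; otherwise `ν` has more parts than `μ`. -/
theorem eq_or_card_lt_of_tail_le {n : ℕ} (μ ν : n.Partition)
    (h : ((rows μ).tail : Multiset ℕ) ≤ ν.parts) :
    ν = μ ∨ Multiset.card μ.parts < Multiset.card ν.parts := by
  obtain ⟨ρ, hρ⟩ := Multiset.le_iff_exists_add.1 h
  have hs := congrArg Multiset.sum hρ
  rw [ν.parts_sum, Multiset.sum_add, Multiset.sum_coe] at hs
  have hf := firstPart_add_tail μ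
  have hρs : ρ.sum = firstPart μ := by omega
  have hcν := congrArg Multiset.card hρ
  rw [Multiset.card_add, Multiset.coe_card] at hcν
  have hμ := coe_rows μ
  unfold firstPart at hρs
  cases hr : rows μ with
  | nil =>
    left
    rw [hr] at hμ
    have : n = 0 := by rw [← μ.parts_sum, ← hμ]; simp
    subst this
    exact Subsingleton.elim _ _
  | cons a l =>
    rw [hr] at hμ hρ hρs hcν
    have ha := pos_of_mem_rows μ (i := a) (by simp [hr])
    simp only [List.tail_cons, List.headD_cons] at hρ hρs hcν
    rcases Nat.lt_or_ge 1 (Multiset.card ρ) with h1 | h1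
    · right
      rw [← hμ, Multiset.coe_card, List.length_cons]
      omega
    · left
      have h0 : Multiset.card ρ ≠ 0 := by
        intro h0
        rw [Multiset.card_eq_zero] at h0
        simp [h0] at hρs
        omega
      obtain ⟨x, rfl⟩ := Multiset.card_eq_one.1 (show Multiset.card ρ = 1 by omega)
      rw [Multiset.sum_singleton] at hρs
      subst hρs
      apply Nat.Partition.ext
      rw [hρ, ← hμ, add_comm, Multiset.singleton_add, Multiset.cons_coe]

theorem exists_rows_tail_eq_of_sublist {n : ℕ} (μ : n.Partition) {l : List ℕ}
    (h : l.Sublist (rows μ).tail) : ∃ ν : n.Partition, (rows ν).tail = l := by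
  have hsum := sum_rows_list μ
  have hp := rows_pairwise μ
  have hpos := fun i => pos_of_mem_rows μ (i := i)
  cases hr : rows μ with
  | nil =>
    refine ⟨μ, ?_⟩
    rw [hr] at h ⊢
    exact (List.sublist_nil.1 h).symm
  | cons a t =>
    rw [hr] at hsum hp h hpos
    simp only [List.tail_cons] at h
    rw [List.sum_cons] at hsum
    have hls : l.sum ≤ t.sum := h.sum_le_sum (by simp)
    have ha := hpos a (by simp)
    rw [List.pairwise_cons] at hp
    -- Whatever is dropped from the tail is added to the first part, which therefore stays the
    -- largest.
    obtain ⟨ν, hν⟩ := exists_rows_eq (n := n) ((n - l.sum) :: l)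
      (List.pairwise_cons.2 ⟨fun i hi => by have := hp.1 i (h.subset hi); omega, hp.2.sublist h⟩)
      (by
        intro i hi
        rcases List.mem_cons.1 hi with rfl | hi
        · omega
        · exact hpos i (List.mem_cons_of_mem _ (h.subset hi)))
      (by rw [List.sum_cons]; omega)
    exact ⟨ν, by rw [hν, List.tail_cons]⟩

theorem linearIndependent_injCount (n : ℕ) :
    LinearIndependent ℂ fun μ : n.Partition => injCount n (rows μ).tail := by
  choose σ hσ using fun μ : n.Partition => exists_perm_partition μ
  refine linearIndependent_of_triangular (fun μ => LinearMap.proj (σ μ)) _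
    (fun μ => Multiset.card μ.parts) (fun μ => ?_) (fun ν μ h => ?_)
  · rw [LinearMap.proj_apply, injCount_ne_zero_iff, hσ, ← coe_rows, Multiset.coe_le]
    exact (List.tail_sublist _).subperm
  · rw [LinearMap.proj_apply, injCount_ne_zero_iff, hσ] at h
    exact eq_or_card_lt_of_tail_le μ ν h

theorem linearIndependent_cycleCountProd (n : ℕ) :
    LinearIndependent ℂ (cycleCountProd : n.Partition → Equiv.Perm (Fin n) → ℂ) := by
  -- The span contains the independent family `injCount`, which has the same number of members.
  rw [linearIndependent_iff_card_le_finrank_span,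
    ← finrank_span_eq_card (linearIndependent_injCount n)]
  refine Submodule.finrank_mono (Submodule.span_le.2 ?_)
  rintro _ ⟨μ, rfl⟩
  refine Submodule.span_mono ?_ (injCount_mem_span n _)
  rintro _ ⟨l, hl, rfl⟩
  obtain ⟨ν, hν⟩ := exists_rows_tail_eq_of_sublist μ hl
  exact ⟨ν, by rw [cycleCountProd, hν]⟩

/-! ### Functions depending on the values of a permutation at few points -/

/-- The indicator function of the permutations that agree with `f` on `S`. -/
def agree {n : ℕ} (S : Finset (Fin n)) (f : Fin n → Fin n) : Equiv.Perm (Fin n) → ℂ :=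
  fun σ => if ∀ x ∈ S, σ x = f x then 1 else 0

/-- The span of the indicator functions of prescribed values at no more than `d` points. -/
def localFunctions (n d : ℕ) : Submodule ℂ (Equiv.Perm (Fin n) → ℂ) :=
  Submodule.span ℂ {F | ∃ S f, S.card ≤ d ∧ agree S f = F}

theorem agree_mem {n d : ℕ} {S : Finset (Fin n)} (f : Fin n → Fin n) (h : S.card ≤ d) :
    agree S f ∈ localFunctions n d :=
  Submodule.subset_span ⟨S, f, h, rfl⟩

theorem one_mem_localFunctions (n d : ℕ) : 1 ∈ localFunctions n d := by
  convert agree_mem (n := n) (d := d) (S := ∅) id (by simp)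
  ext σ
  simp [agree]

/-- The product of two indicators prescribes values on the union of the two sets, or is zero if the
prescriptions conflict. -/
theorem mul_mem_localFunctions {n d e : ℕ} {F G : Equiv.Perm (Fin n) → ℂ}
    (hF : F ∈ localFunctions n d) (hG : G ∈ localFunctions n e) :
    F * G ∈ localFunctions n (d + e) := by
  classical
  have key : F * G ∈ localFunctions n d * localFunctions n e := Submodule.mul_mem_mul hF hG
  rw [localFunctions, localFunctions, Submodule.span_mul_span] at key
  refine Submodule.span_le.2 ?_ key
  rintro _ ⟨_, ⟨S, f, hS, rfl⟩, _, ⟨T, g, hT, rfl⟩, rfl⟩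
  by_cases hfg : ∀ x ∈ S, x ∈ T → f x = g x
  · have : agree S f * agree T g = agree (S ∪ T) (fun x => if x ∈ S then f x else g x) := by
      ext σ
      have hiff : (∀ x ∈ S ∪ T, σ x = if x ∈ S then f x else g x) ↔
          (∀ x ∈ S, σ x = f x) ∧ ∀ x ∈ T, σ x = g x := by
        constructor
        · intro h
          refine ⟨fun x hx => by simpa [hx] using h x (by simp [hx]), fun x hx => ?_⟩
          have h1 := h x (by simp [hx])
          split_ifs at h1 with hxS
          · rw [h1, hfg x hxS hx]
          · exact h1
        · rintro ⟨h1, h2⟩ x hx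
          split_ifs with hxS
          · exact h1 x hxS
          · exact h2 x ((Finset.mem_union.1 hx).resolve_left hxS)
      simp only [Pi.mul_apply, agree, hiff, ite_and]
      split_ifs <;> simp
    simp only [this]
    exact agree_mem _ ((Finset.card_union_le _ _).trans (add_le_add hS hT))
  · have : agree S f * agree T g = 0 := by
      ext σ
      simp only [Pi.mul_apply, agree, Pi.zero_apply]
      split_ifs with h1 h2
      · exact absurd (fun x hx hx' => (h1 x hx).symm.trans (h2 x hx')) hfg
      all_goals simp
    simp only [this]
    exact Submodule.zero_mem _

open scoped Classical in
-- An `i`-cycle `c` is a cycle of `σ` exactly when `σ` agrees with `c` on the support of `c`. Fixed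
-- points have empty support, hence the bound `2 ≤ i`.
theorem cycleCount_eq_sum_agree {n i : ℕ} (hi : 2 ≤ i) :
    cycleCount n i = ∑ c : Equiv.Perm (Fin n) with c.IsCycle ∧ c.support.card = i,
      agree c.support c := by
  ext σ
  have h1 : σ.partition.parts.count i = σ.cycleType.count i := by
    rw [Equiv.Perm.parts_partition, Multiset.count_add, Multiset.count_replicate,
      if_neg (by omega), add_zero]
  have h2 : σ.cycleType.count i =
      (σ.cycleFactorsFinset.filter fun c => c.support.card = i).card := by
    rw [Equiv.Perm.cycleType_def, Multiset.count_map, Finset.card_def, Finset.filter_val]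
    simp only [Function.comp_apply, eq_comm]
  rw [cycleCount, h1, h2, Finset.sum_apply, Finset.card_eq_sum_ones, Nat.cast_sum]
  simp only [agree]
  rw [← Finset.sum_filter, Finset.filter_filter, Nat.cast_one]
  refine Finset.sum_congr ?_ fun _ _ => rfl
  ext c
  simp only [Finset.mem_filter, Finset.mem_univ, true_and,
    Equiv.Perm.mem_cycleFactorsFinset_iff, eq_comm (a := σ _)]
  tauto

theorem cycleCount_one_eq_sum_agree (n : ℕ) :
    cycleCount n 1 = ∑ a : Fin n, agree {a} id := by
  ext σ
  have h1 : σ.partition.parts.count 1 = n - σ.support.card := by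
    rw [Equiv.Perm.parts_partition, Multiset.count_add, Multiset.count_replicate_self,
      Fintype.card_fin, Multiset.count_eq_zero_of_notMem, zero_add]
    intro h
    have := Equiv.Perm.two_le_of_mem_cycleType h
    omega
  rw [cycleCount, h1, Finset.sum_apply]
  simp only [agree, Finset.mem_singleton, forall_eq, id]
  rw [Finset.sum_boole]
  congr 1
  have h2 := Finset.card_compl σ.support
  rw [Fintype.card_fin] at h2
  rw [← h2]
  congr 1
  ext a
  simp

theorem cycleCount_mem_localFunctions {n i : ℕ} (hi : 0 < i) :
    cycleCount n i ∈ localFunctions n i := by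
  classical
  rcases Nat.lt_or_ge 1 i with h | h
  · rw [cycleCount_eq_sum_agree h]
    exact Submodule.sum_mem _ fun c hc => agree_mem _ (Finset.mem_filter.1 hc).2.2.le
  · obtain rfl : i = 1 := by omega
    rw [cycleCount_one_eq_sum_agree]
    exact Submodule.sum_mem _ fun c _ => agree_mem _ (by simp)

theorem prod_cycleCount_mem_localFunctions {n : ℕ} (l : List ℕ) (hl : ∀ i ∈ l, 0 < i) :
    (l.map (cycleCount n)).prod ∈ localFunctions n l.sum := by
  induction l with
  | nil => exact one_mem_localFunctions n 0
  | cons a l ih =>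
    rw [List.map_cons, List.prod_cons, List.sum_cons]
    exact mul_mem_localFunctions (cycleCount_mem_localFunctions (hl a (by simp)))
      (ih fun i hi => hl i (List.mem_cons_of_mem _ hi))

theorem cycleCountProd_mem_localFunctions {n : ℕ} (μ : n.Partition) :
    cycleCountProd μ ∈ localFunctions n (n - firstPart μ) := by
  have h := firstPart_add_tail μ
  rw [show n - firstPart μ = (rows μ).tail.sum by omega]
  exact prod_cycleCount_mem_localFunctions _ fun i hi =>
    pos_of_mem_rows μ (List.mem_of_mem_tail hi)

/-! ### The tableau -/

theorem mem_rowGroup {n : ℕ} {μ : n.Partition} {σ : Equiv.Perm (Fin n)} :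
    σ ∈ rowGroup μ ↔ ∀ a, rowOf μ (σ a) = rowOf μ a := by
  simp [rowGroup]

theorem mem_colGroup {n : ℕ} {μ : n.Partition} {σ : Equiv.Perm (Fin n)} :
    σ ∈ colGroup μ ↔ ∀ a, colOf μ (σ a) = colOf μ a := by
  simp [colGroup]

theorem swap_mem_rowGroup {n : ℕ} {μ : n.Partition} {u v : Fin n} (h : rowOf μ u = rowOf μ v) :
    Equiv.swap u v ∈ rowGroup μ := by
  rw [mem_rowGroup]
  intro a
  rw [Equiv.swap_apply_def]
  split_ifs <;> simp_all

theorem swap_mem_colGroup {n : ℕ} {μ : n.Partition} {u v : Fin n} (h : colOf μ u = colOf μ v) :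
    Equiv.swap u v ∈ colGroup μ := by
  rw [mem_colGroup]
  intro a
  rw [Equiv.swap_apply_def]
  split_ifs <;> simp_all

theorem mul_mem_colGroup {n : ℕ} {μ : n.Partition} {σ τ : Equiv.Perm (Fin n)}
    (hσ : σ ∈ colGroup μ) (hτ : τ ∈ colGroup μ) : σ * τ ∈ colGroup μ := by
  rw [mem_colGroup] at *
  intro a
  rw [Equiv.Perm.mul_apply, hσ, hτ]

theorem mul_mem_rowGroup {n : ℕ} {μ : n.Partition} {σ τ : Equiv.Perm (Fin n)}
    (hσ : σ ∈ rowGroup μ) (hτ : τ ∈ rowGroup μ) : σ * τ ∈ rowGroup μ := by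
  rw [mem_rowGroup] at *
  intro a
  rw [Equiv.Perm.mul_apply, hσ, hτ]

theorem rowOf_colOf_injective {n : ℕ} (μ : n.Partition) {a b : Fin n}
    (hr : rowOf μ a = rowOf μ b) (hc : colOf μ a = colOf μ b) : a = b := by
  apply (tableau μ).injective
  unfold rowOf at hr
  unfold colOf at hc
  generalize tableau μ a = x at *
  generalize tableau μ b = y at *
  obtain ⟨i, j⟩ := x
  obtain ⟨i', j'⟩ := y
  obtain rfl : i = i' := Fin.ext hr
  obtain rfl : j = j' := Fin.ext hc
  rfl

theorem rowOf_lt {n : ℕ} (μ : n.Partition) (a : Fin n) : rowOf μ a < (rows μ).length :=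
  (tableau μ a).1.2

theorem exists_rowOf_colOf_iff {n : ℕ} (μ : n.Partition) (i j : ℕ) :
    (∃ a, rowOf μ a = i ∧ colOf μ a = j) ↔ j < (rows μ).getD i 0 := by
  constructor
  · rintro ⟨a, rfl, rfl⟩
    rw [List.getD_eq_getElem _ _ (rowOf_lt μ a)]
    exact (tableau μ a).2.2
  · intro h
    have hi : i < (rows μ).length := by
      by_contra hi
      rw [List.getD_eq_default _ _ (not_lt.1 hi)] at h
      omega
    rw [List.getD_eq_getElem _ _ hi] at h
    have e := (tableau μ).apply_symm_apply ⟨⟨i, hi⟩, ⟨j, h⟩⟩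
    exact ⟨_, congrArg (fun x : Cell μ => (x.1 : ℕ)) e, congrArg (fun x : Cell μ => (x.2 : ℕ)) e⟩

theorem colOf_lt_getD {n : ℕ} (μ : n.Partition) (a : Fin n) :
    colOf μ a < (rows μ).getD (rowOf μ a) 0 :=
  (exists_rowOf_colOf_iff μ _ _).1 ⟨a, rfl, rfl⟩

theorem getD_rows_antitone {n : ℕ} (μ : n.Partition) : Antitone fun i => (rows μ).getD i 0 := by
  intro i j hij
  have h := rows_pairwise μ
  rcases Nat.lt_or_ge j (rows μ).length with hj | hj
  · rcases hij.eq_or_lt with rfl | hlt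
    · rfl
    · simp only
      rw [List.getD_eq_getElem _ _ hj, List.getD_eq_getElem _ _ (hij.trans_lt hj)]
      exact List.pairwise_iff_getElem.1 h _ _ _ _ hlt
  · simp only
    rw [List.getD_eq_default _ _ hj]
    exact Nat.zero_le _

theorem firstPart_eq_getD {n : ℕ} (μ : n.Partition) : firstPart μ = (rows μ).getD 0 0 := by
  unfold firstPart
  cases rows μ <;> simp

theorem colOf_lt_firstPart {n : ℕ} (μ : n.Partition) (a : Fin n) : colOf μ a < firstPart μ := by
  rw [firstPart_eq_getD]
  exact (colOf_lt_getD μ a).trans_le (getD_rows_antitone μ (Nat.zero_le _))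

/-- Local functions are killed by antisymmetrization over the column group. -/
theorem sum_colGroup_sign_mul_eq_zero {n d : ℕ} {F : Equiv.Perm (Fin n) → ℂ}
    (hF : F ∈ localFunctions n d) (μ : n.Partition) (hd : d + firstPart μ < n)
    (g : Equiv.Perm (Fin n)) :
    ∑ q ∈ colGroup μ, ((Equiv.Perm.sign q : ℤ) : ℂ) * F (g * q) = 0 := by
  classical
  induction hF using Submodule.span_induction with
  | mem F hF =>
    obtain ⟨S, f, hS, rfl⟩ := hF
    -- Pigeonhole: at least `n - d` points lie outside `S`, more than there are columns.
    obtain ⟨u, hu, v, hv, huv, hc⟩ := Finset.exists_ne_map_eq_of_card_lt_of_maps_to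
      (s := Sᶜ) (t := Finset.range (firstPart μ)) (f := colOf μ)
      (by rw [Finset.card_range, Finset.card_compl, Fintype.card_fin]; omega)
      (fun a _ => by simpa using colOf_lt_firstPart μ a)
    rw [Finset.mem_compl] at hu hv
    have hx : ∀ x ∈ S, Equiv.swap u v x = x := fun x hx =>
      Equiv.swap_apply_of_ne_of_ne (fun h => hu (h ▸ hx)) (fun h => hv (h ▸ hx))
    -- Right multiplication by the transposition reverses the sign and leaves the values on `S`
    -- unchanged, so the terms cancel in pairs.
    refine Finset.sum_involution (fun q _ => q * Equiv.swap u v) ?_ ?_ ?_ ?_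
    · intro q _
      have h1 : agree S f (g * (q * Equiv.swap u v)) = agree S f (g * q) := by
        unfold agree
        congr 1
        refine propext (forall₂_congr fun x hxS => ?_)
        simp only [Equiv.Perm.mul_apply, hx x hxS]
      rw [h1, Equiv.Perm.sign_mul, Equiv.Perm.sign_swap huv]
      push_cast
      ring
    · intro q _ _ h
      have h2 : Equiv.swap u v = 1 := mul_left_cancel (h.trans (mul_one q).symm)
      exact huv (Equiv.swap_eq_one_iff.1 h2)
    · intro q hq
      exact mul_mem_colGroup hq (swap_mem_colGroup hc)
    · intro q _
      rw [mul_assoc, Equiv.swap_mul_self, mul_one]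
  | zero => simp
  | add F G _ _ hF hG =>
    simp only [Pi.add_apply, mul_add, Finset.sum_add_distrib, hF, hG, add_zero]
  | smul c F _ hF =>
    simp only [Pi.smul_apply, smul_eq_mul, mul_left_comm _ c, ← Finset.mul_sum, hF, mul_zero]

/-! ### The dominance order -/

/-- The number of cells in the first `r` rows. -/
def cellsAbove {n : ℕ} (μ : n.Partition) (r : ℕ) : ℕ :=
  (Finset.univ.filter fun a : Fin n => rowOf μ a < r).card

theorem card_row {n : ℕ} (μ : n.Partition) (r : ℕ) :
    (Finset.univ.filter fun a : Fin n => rowOf μ a = r).card = (rows μ).getD r 0 := by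
  rw [← Finset.card_range ((rows μ).getD r 0)]
  refine Finset.card_nbij (colOf μ) ?_ ?_ ?_
  · intro a ha
    obtain rfl := (Finset.mem_filter.1 ha).2
    exact Finset.mem_coe.2 (Finset.mem_range.2 (colOf_lt_getD μ a))
  · intro a ha b hb hab
    exact rowOf_colOf_injective μ
      ((Finset.mem_filter.1 ha).2.trans (Finset.mem_filter.1 hb).2.symm) hab
  · intro j hj
    obtain ⟨a, ha, haj⟩ := (exists_rowOf_colOf_iff μ r j).2 (Finset.mem_range.1 (Finset.mem_coe.1 hj))
    exact ⟨a, by simpa using ha, haj⟩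

theorem cellsAbove_succ {n : ℕ} (μ : n.Partition) (r : ℕ) :
    cellsAbove μ (r + 1) = cellsAbove μ r + (rows μ).getD r 0 := by
  classical
  rw [← card_row, cellsAbove, cellsAbove, ← Finset.card_union_of_disjoint]
  · congr 1
    ext a
    simp only [Finset.mem_filter, Finset.mem_univ, true_and, Finset.mem_union]
    omega
  · rw [Finset.disjoint_filter]
    intro a _ h
    omega

theorem cellsAbove_one {n : ℕ} (μ : n.Partition) : cellsAbove μ 1 = firstPart μ := by
  rw [cellsAbove_succ, firstPart_eq_getD]
  simp [cellsAbove]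

theorem cellsAbove_of_le {n : ℕ} (μ : n.Partition) {r : ℕ} (hr : n ≤ r) : cellsAbove μ r = n := by
  have hlen : (rows μ).length ≤ n := by
    conv_rhs => rw [← sum_rows_list μ]
    exact List.length_le_sum_of_one_le _ fun i hi => pos_of_mem_rows μ hi
  rw [cellsAbove, Finset.filter_true_of_mem, Finset.card_univ, Fintype.card_fin]
  intro a _
  have := rowOf_lt μ a
  omega

theorem eq_of_cellsAbove_eq {n : ℕ} {μ ν : n.Partition} (h : ∀ r, cellsAbove μ r = cellsAbove ν r) :
    μ = ν := by
  have hg : ∀ r, (rows μ).getD r 0 = (rows ν).getD r 0 := by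
    intro r
    have h1 := h (r + 1)
    rw [cellsAbove_succ, cellsAbove_succ, h r] at h1
    omega
  have hlt : ∀ (μ : n.Partition) r, 0 < (rows μ).getD r 0 ↔ r < (rows μ).length := by
    intro μ r
    rcases Nat.lt_or_ge r (rows μ).length with hr | hr
    · rw [List.getD_eq_getElem _ _ hr]
      exact iff_of_true (pos_of_mem_rows μ (List.getElem_mem hr)) hr
    · rw [List.getD_eq_default _ _ hr]
      omega
  apply rows_injective
  refine List.ext_getElem ?_ fun r h1 h2 => ?_
  · have h1 := hlt μ (rows ν).length
    have h2 := hlt ν (rows μ).length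
    rw [hg] at h1
    rw [← hg] at h2
    have h3 := hlt μ (rows μ).length
    have h4 := hlt ν (rows ν).length
    omega
  · have := hg r
    rwa [List.getD_eq_getElem _ _ h1, List.getD_eq_getElem _ _ h2] at this

/-- The sum of all the partial sums of the parts. -/
def dominanceHeight {n : ℕ} (μ : n.Partition) : ℕ :=
  ∑ r ∈ Finset.range n, cellsAbove μ r

/-- Turns dominance into a strict comparison of natural numbers, as the triangularity lemma
requires. -/
theorem eq_or_dominanceHeight_lt {n : ℕ} {μ ν : n.Partition}
    (h : ∀ r, cellsAbove μ r ≤ cellsAbove ν r) :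
    ν = μ ∨ dominanceHeight μ < dominanceHeight ν := by
  rcases (Finset.sum_le_sum fun r (_ : r ∈ Finset.range n) => h r).eq_or_lt with he | hlt
  · left
    rw [Finset.sum_eq_sum_iff_of_le fun r _ => h r] at he
    refine (eq_of_cellsAbove_eq fun r => ?_).symm
    rcases Nat.lt_or_ge r n with hr | hr
    · exact he r (Finset.mem_range.2 hr)
    · rw [cellsAbove_of_le _ hr, cellsAbove_of_le _ hr]
  · exact Or.inr hlt

/-- Columns are filled from the top: if `T` reaches below row `r`, its column has a cell in each of
the first `r` rows. -/
theorem card_le_card_col_above {n : ℕ} (μ : n.Partition) (j r : ℕ) (T : Finset (Fin n))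
    (hT : ∀ a ∈ T, colOf μ a = j) (hr : T.card ≤ r) :
    T.card ≤ (Finset.univ.filter fun a : Fin n => rowOf μ a < r ∧ colOf μ a = j).card := by
  by_cases h : ∀ a ∈ T, rowOf μ a < r
  · exact Finset.card_le_card fun a ha => by simp [h a ha, hT a ha]
  · push Not at h
    obtain ⟨b, hb, hbr⟩ := h
    refine hr.trans ?_
    calc r = (Finset.range r).card := (Finset.card_range r).symm
      _ ≤ ((Finset.univ.filter fun a : Fin n => rowOf μ a < r ∧ colOf μ a = j).image
          (rowOf μ)).card := by
        refine Finset.card_le_card fun i hi => ?_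
        rw [Finset.mem_range] at hi
        have hlt := colOf_lt_getD μ b
        rw [hT b hb] at hlt
        obtain ⟨a, ha, haj⟩ := (exists_rowOf_colOf_iff μ i j).2
          (hlt.trans_le (getD_rows_antitone μ (by omega)))
        exact Finset.mem_image.2 ⟨a, by simp [ha, haj, hi], ha⟩
      _ ≤ _ := Finset.card_image_le

/-- Entries of the first `r` rows of `μ` sent by `g` into one column of `ν` come from distinct rows,
so there are at most `r` of them. Pushed up within each column, they fit into the first `r` rows of
`ν`. -/
theorem cellsAbove_le_of_injective {n : ℕ} (μ ν : n.Partition) (g : Equiv.Perm (Fin n))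
    (h : ∀ u v, rowOf μ u = rowOf μ v → colOf ν (g u) = colOf ν (g v) → u = v) (r : ℕ) :
    cellsAbove μ r ≤ cellsAbove ν r := by
  classical
  have h1 : cellsAbove μ r = (Finset.univ.filter fun a : Fin n => rowOf μ (g.symm a) < r).card := by
    refine Finset.card_equiv g fun a => ?_
    simp
  rw [h1, cellsAbove, Finset.card_eq_sum_card_fiberwise (f := colOf ν)
    (t := Finset.range (firstPart ν)) fun a _ => by simpa using colOf_lt_firstPart ν a,
    Finset.card_eq_sum_card_fiberwise (f := colOf ν) (s := Finset.univ.filter _)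
    (t := Finset.range (firstPart ν)) fun a _ => by simpa using colOf_lt_firstPart ν a]
  refine Finset.sum_le_sum fun j _ => ?_
  conv_rhs => rw [Finset.filter_filter]
  refine card_le_card_col_above ν j r _ (fun a ha => (Finset.mem_filter.1 ha).2) ?_
  rw [← Finset.card_range r]
  refine Finset.card_le_card_of_injOn (fun a => rowOf μ (g.symm a)) ?_ ?_
  · intro a ha
    simp only [Finset.coe_filter, Finset.mem_filter, Set.mem_ofPred_eq] at ha
    simpa using ha.1.2
  · intro a ha b hb hab
    simp only [Finset.coe_filter, Finset.mem_filter, Set.mem_ofPred_eq] at ha hb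
    have := h (g.symm a) (g.symm b) hab (by simp [ha.2, hb.2])
    exact g.symm.injective this

/-! ### Row and column sums in the group algebra -/

/-- The sum of the row group in the group algebra. -/
def rowSum {n : ℕ} (μ : n.Partition) : MonoidAlgebra ℂ (Equiv.Perm (Fin n)) :=
  ∑ p ∈ rowGroup μ, MonoidAlgebra.of ℂ (Equiv.Perm (Fin n)) p

/-- The signed sum of the column group in the group algebra. -/
def colSum {n : ℕ} (μ : n.Partition) : MonoidAlgebra ℂ (Equiv.Perm (Fin n)) :=
  ∑ q ∈ colGroup μ, ((Equiv.Perm.sign q : ℤ) : ℂ) • MonoidAlgebra.of ℂ (Equiv.Perm (Fin n)) q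

theorem youngSymmetrizer_eq {n : ℕ} (μ : n.Partition) :
    youngSymmetrizer μ = rowSum μ * colSum μ := rfl

theorem colSum_mul_swap {n : ℕ} {μ : n.Partition} {u v : Fin n} (huv : u ≠ v)
    (h : colOf μ u = colOf μ v) :
    colSum μ * MonoidAlgebra.of ℂ _ (Equiv.swap u v) = -colSum μ := by
  rw [colSum, Finset.sum_mul, ← Finset.sum_neg_distrib]
  refine Finset.sum_nbij' (· * Equiv.swap u v) (· * Equiv.swap u v)
    (fun q hq => mul_mem_colGroup hq (swap_mem_colGroup h))
    (fun q hq => mul_mem_colGroup hq (swap_mem_colGroup h))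
    (fun q _ => by simp [mul_assoc]) (fun q _ => by simp [mul_assoc]) fun q _ => ?_
  rw [smul_mul_assoc, ← map_mul, Equiv.Perm.sign_mul, Equiv.Perm.sign_swap huv]
  simp

theorem swap_mul_rowSum {n : ℕ} {μ : n.Partition} {u v : Fin n} (h : rowOf μ u = rowOf μ v) :
    MonoidAlgebra.of ℂ _ (Equiv.swap u v) * rowSum μ = rowSum μ := by
  rw [rowSum, Finset.mul_sum]
  refine Finset.sum_nbij' (Equiv.swap u v * ·) (Equiv.swap u v * ·)
    (fun q hq => mul_mem_rowGroup (swap_mem_rowGroup h) hq)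
    (fun q hq => mul_mem_rowGroup (swap_mem_rowGroup h) hq)
    (fun q _ => by simp) (fun q _ => by simp) fun q _ => ?_
  rw [← map_mul]

/-- When dominance fails, `g` sends two entries of one row of `μ` to one column of `ν`. Their
transposition is absorbed by the row sum with sign `+1` and, moved past `g`, by the column sum with
sign `-1`, so the product is its own negative. -/
theorem colSum_mul_mul_rowSum_eq_zero {n : ℕ} {μ ν : n.Partition}
    (h : ¬ ∀ r, cellsAbove μ r ≤ cellsAbove ν r) (x : MonoidAlgebra ℂ (Equiv.Perm (Fin n))) :
    colSum ν * x * rowSum μ = 0 := by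
  induction x using MonoidAlgebra.induction_on with
  | of g =>
    have hg : ∃ u v, rowOf μ u = rowOf μ v ∧ colOf ν (g u) = colOf ν (g v) ∧ u ≠ v := by
      by_contra hcon
      push Not at hcon
      exact h (cellsAbove_le_of_injective μ ν g hcon)
    obtain ⟨u, v, hr, hc, huv⟩ := hg
    have hconj : Equiv.swap (g u) (g v) * g = g * Equiv.swap u v := by
      rw [Equiv.mul_swap_eq_swap_mul]
    have key : colSum ν * MonoidAlgebra.of ℂ _ g * rowSum μ =
        -(colSum ν * MonoidAlgebra.of ℂ _ g * rowSum μ) := by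
      conv_lhs => rw [← swap_mul_rowSum hr, ← mul_assoc, mul_assoc (colSum ν), ← map_mul, ← hconj,
        map_mul, ← mul_assoc, colSum_mul_swap (g.injective.ne huv) hc, neg_mul, neg_mul]
    rw [eq_neg_iff_add_eq_zero, ← two_smul ℂ] at key
    exact ((IsUnit.mk0 (2 : ℂ) two_ne_zero).smul_eq_zero).1 key
  | add x y hx hy => rw [mul_add, add_mul, hx, hy, add_zero]
  | smul r x hx => rw [mul_smul_comm, smul_mul_assoc, hx, smul_zero]

theorem youngSymmetrizer_ne_zero {n : ℕ} (μ : n.Partition) : youngSymmetrizer μ ≠ 0 := by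
  intro h
  have h1 := congrArg (fun x => x.coeff 1) h
  revert h1
  rw [youngSymmetrizer, Finset.sum_mul_sum]
  simp only [mul_smul_comm, MonoidAlgebra.single_mul_single, mul_one, MonoidAlgebra.coeff_sum,
    MonoidAlgebra.coeff_smul, Finsupp.coe_finsetSum, Finset.sum_apply, Finsupp.smul_apply,
    MonoidAlgebra.of_apply, MonoidAlgebra.coeff_single, Finsupp.single_apply,
    MonoidAlgebra.coeff_zero, Finsupp.coe_zero, Pi.zero_apply]
  -- The row and column groups meet trivially, so the coefficient of the identity in the symmetrizer
  -- is `1`.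
  have hone : ∀ p ∈ rowGroup μ, ∀ q ∈ colGroup μ, p * q = 1 → p = 1 ∧ q = 1 := by
    intro p hp q hq hpq
    have hq1 : q = 1 := by
      ext a
      congr 1
      refine rowOf_colOf_injective μ ?_ (mem_colGroup.1 hq a)
      have := mem_rowGroup.1 hp (q a)
      rw [← Equiv.Perm.mul_apply, hpq] at this
      exact this.symm
    exact ⟨by simpa [hq1] using hpq, hq1⟩
  have h1r : 1 ∈ rowGroup μ := by simp [mem_rowGroup]
  have h1c : 1 ∈ colGroup μ := by simp [mem_colGroup]
  rw [Finset.sum_eq_single_of_mem 1 h1r, Finset.sum_eq_single_of_mem 1 h1c]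
  · simp
  · intro q hq hq1
    rw [if_neg fun h => hq1 (hone 1 h1r q hq h).2, smul_zero]
  · intro p hp hp1
    refine Finset.sum_eq_zero fun q hq => ?_
    rw [if_neg fun h => hp1 (hone p hp q hq h).1, smul_zero]

/-! ### Functions on the group as functionals on the group algebra -/

/-- The value at `x` of the linear extension of `f` to the group algebra. -/
def pairing (n : ℕ) :
    MonoidAlgebra ℂ (Equiv.Perm (Fin n)) →ₗ[ℂ] (Equiv.Perm (Fin n) → ℂ) →ₗ[ℂ] ℂ :=
  Finsupp.linearCombination ℂ (fun g : Equiv.Perm (Fin n) => LinearMap.proj g) ∘ₗ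
    (MonoidAlgebra.coeffLinearEquiv ℂ).toLinearMap

theorem pairing_of {n : ℕ} (g : Equiv.Perm (Fin n)) (f : Equiv.Perm (Fin n) → ℂ) :
    pairing n (MonoidAlgebra.of ℂ _ g) f = f g := by
  simp [pairing]

theorem pairing_mul_colSum_eq_zero {n d : ℕ} {F : Equiv.Perm (Fin n) → ℂ}
    (hF : F ∈ localFunctions n d) (μ : n.Partition) (hd : d + firstPart μ < n)
    (x : MonoidAlgebra ℂ (Equiv.Perm (Fin n))) : pairing n (x * colSum μ) F = 0 := by
  induction x using MonoidAlgebra.induction_on with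
  | of g =>
    rw [← sum_colGroup_sign_mul_eq_zero hF μ hd g, colSum, Finset.mul_sum, map_sum,
      LinearMap.sum_apply]
    refine Finset.sum_congr rfl fun q _ => ?_
    rw [mul_smul_comm, ← map_mul, map_smul, LinearMap.smul_apply, pairing_of, smul_eq_mul]
  | add x y hx hy => rw [add_mul, map_add, LinearMap.add_apply, hx, hy, add_zero]
  | smul r x hx => rw [smul_mul_assoc, map_smul, LinearMap.smul_apply, hx, smul_zero]

theorem pairing_chi {n : ℕ} (μ : n.Partition) (x : MonoidAlgebra ℂ (Equiv.Perm (Fin n))) :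
    pairing n x (chi μ) = LinearMap.trace ℂ (Specht μ) (Algebra.lsmul ℂ ℂ (Specht μ) x) := by
  induction x using MonoidAlgebra.induction_on with
  | of g =>
    rw [pairing_of]
    rfl
  | add x y hx hy => rw [map_add, LinearMap.add_apply, hx, hy, map_add, map_add]
  | smul r x hx => rw [map_smul, LinearMap.smul_apply, hx, map_smul, map_smul]

/-! ### Independence of the irreducible characters -/

theorem exists_spechtIdempotent {n : ℕ} (μ : n.Partition) :
    ∃ e : MonoidAlgebra ℂ (Equiv.Perm (Fin n)), IsIdempotentElem e ∧ Specht μ = .span {e} :=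
  IsSemisimpleRing.ideal_eq_span_idempotent _

/-- An idempotent generator of the Specht module. -/
def spechtIdempotent {n : ℕ} (μ : n.Partition) : MonoidAlgebra ℂ (Equiv.Perm (Fin n)) :=
  (exists_spechtIdempotent μ).choose

theorem isIdempotentElem_spechtIdempotent {n : ℕ} (μ : n.Partition) :
    IsIdempotentElem (spechtIdempotent μ) :=
  (exists_spechtIdempotent μ).choose_spec.1

theorem specht_eq_span {n : ℕ} (μ : n.Partition) : Specht μ = .span {spechtIdempotent μ} :=
  (exists_spechtIdempotent μ).choose_spec.2

theorem spechtIdempotent_mem {n : ℕ} (μ : n.Partition) : spechtIdempotent μ ∈ Specht μ := by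
  rw [specht_eq_span]
  exact Ideal.mem_span_singleton_self _

theorem exists_eq_mul_rowSum_mul_colSum {n : ℕ} {μ : n.Partition}
    {y : MonoidAlgebra ℂ (Equiv.Perm (Fin n))} (hy : y ∈ Specht μ) :
    ∃ z, y = z * rowSum μ * colSum μ := by
  obtain ⟨z, hz⟩ := Ideal.mem_span_singleton'.1 hy
  exact ⟨z, by rw [← hz, youngSymmetrizer_eq, mul_assoc]⟩

theorem spechtIdempotent_ne_zero {n : ℕ} (μ : n.Partition) : spechtIdempotent μ ≠ 0 := by
  intro h
  have h1 : youngSymmetrizer μ ∈ Specht μ := Ideal.mem_span_singleton_self _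
  rw [specht_eq_span, h, Ideal.span_singleton_eq_bot.2 rfl, Ideal.mem_bot] at h1
  exact youngSymmetrizer_ne_zero μ h1

theorem trace_ne_zero_of_isIdempotentElem {V : Type*} [AddCommGroup V] [Module ℂ V]
    [FiniteDimensional ℂ V] {e : V →ₗ[ℂ] V} (he : IsIdempotentElem e) (h0 : e ≠ 0) :
    LinearMap.trace ℂ V e ≠ 0 :=
  fun h => h0 ((LinearMap.IsIdempotentElem.trace_eq_zero_iff he).1 h)

/-- The idempotent acts on its own ideal as a projection that fixes itself, hence is nonzero, and in
characteristic zero a nonzero projection has nonzero trace. -/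
theorem pairing_spechtIdempotent_chi_self {n : ℕ} (μ : n.Partition) :
    pairing n (spechtIdempotent μ) (chi μ) ≠ 0 := by
  rw [pairing_chi]
  refine trace_ne_zero_of_isIdempotentElem
    ((isIdempotentElem_spechtIdempotent μ).map (Algebra.lsmul ℂ ℂ (Specht μ))) ?_
  intro h
  have h1 := LinearMap.congr_fun h ⟨_, spechtIdempotent_mem μ⟩
  have h2 := congrArg Subtype.val h1
  exact spechtIdempotent_ne_zero μ ((isIdempotentElem_spechtIdempotent μ).symm.trans h2)

/-- Without dominance the idempotent of `ν` annihilates the whole Specht module of `μ`, so its trace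
there is zero. -/
theorem cellsAbove_le_of_pairing_ne_zero {n : ℕ} {μ ν : n.Partition}
    (h : pairing n (spechtIdempotent ν) (chi μ) ≠ 0) (r : ℕ) :
    cellsAbove μ r ≤ cellsAbove ν r := by
  revert r
  by_contra hcon
  apply h
  rw [pairing_chi]
  convert map_zero (LinearMap.trace ℂ (Specht μ))
  refine LinearMap.ext fun ⟨y, hy⟩ => Subtype.ext ?_
  obtain ⟨w, rfl⟩ := exists_eq_mul_rowSum_mul_colSum hy
  obtain ⟨z, hz⟩ := exists_eq_mul_rowSum_mul_colSum (spechtIdempotent_mem ν)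
  have : spechtIdempotent ν * (w * rowSum μ * colSum μ) = 0 := by
    rw [hz, show z * rowSum ν * colSum ν * (w * rowSum μ * colSum μ)
      = z * rowSum ν * (colSum ν * w * rowSum μ) * colSum μ by simp only [mul_assoc],
      colSum_mul_mul_rowSum_eq_zero hcon, mul_zero, zero_mul]
  exact this

theorem eq_or_dominanceHeight_lt_of_pairing_ne_zero {n : ℕ} (ν μ : n.Partition)
    (h : pairing n (spechtIdempotent ν) (chi μ) ≠ 0) :
    ν = μ ∨ dominanceHeight μ < dominanceHeight ν :=
  eq_or_dominanceHeight_lt (cellsAbove_le_of_pairing_ne_zero h)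

theorem linearIndependent_chi (n : ℕ) :
    LinearIndependent ℂ (chi : n.Partition → Equiv.Perm (Fin n) → ℂ) :=
  linearIndependent_of_triangular (fun ν => pairing n (spechtIdempotent ν)) _ dominanceHeight
    pairing_spechtIdempotent_chi_self eq_or_dominanceHeight_lt_of_pairing_ne_zero

/-! ### Class functions -/

/-- The functions of the cycle type. -/
def classFunctions (n : ℕ) : Submodule ℂ (Equiv.Perm (Fin n) → ℂ) :=
  LinearMap.range (LinearMap.funLeft ℂ ℂ (Equiv.Perm.partition (α := Fin n)))

theorem finrank_classFunctions_le (n : ℕ) :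
    Module.finrank ℂ (classFunctions n) ≤ Fintype.card n.Partition := by
  refine (LinearMap.finrank_range_le _).trans ?_
  rw [Module.finrank_fintype_fun_eq_card, Fintype.card_fin]

theorem mem_classFunctions_of_isConj {n : ℕ} {f : Equiv.Perm (Fin n) → ℂ}
    (hf : ∀ σ τ, IsConj σ τ → f σ = f τ) : f ∈ classFunctions n := by
  have hfac : Function.FactorsThrough f (Equiv.Perm.partition (α := Fin n)) := fun σ τ h =>
    hf σ τ (Equiv.Perm.partition_eq_of_isConj.2 h)
  exact ⟨Function.extend _ f 0, funext fun σ => hfac.extend_apply _ _⟩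

theorem chi_mem_classFunctions {n : ℕ} (μ : n.Partition) : chi μ ∈ classFunctions n := by
  refine mem_classFunctions_of_isConj fun σ τ h => ?_
  obtain ⟨c, rfl⟩ := isConj_iff.1 h
  exact (Representation.char_conj _ _ _).symm

theorem cycleCountProd_mem_classFunctions {n : ℕ} (μ : n.Partition) :
    cycleCountProd μ ∈ classFunctions n := by
  refine mem_classFunctions_of_isConj fun σ τ h => ?_
  have hp := Equiv.Perm.partition_eq_of_isConj.1 h
  unfold cycleCountProd
  induction (rows μ).tail with
  | nil => rfl
  | cons a l ih => simp only [List.map_cons, List.prod_cons, Pi.mul_apply, ih, cycleCount, hp]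

theorem classFunctions_le_span_chi (n : ℕ) :
    classFunctions n ≤ Submodule.span ℂ (Set.range (chi : n.Partition → _)) := by
  refine (Submodule.eq_of_le_of_finrank_le (Submodule.span_le.2 ?_) ?_).ge
  · rintro _ ⟨μ, rfl⟩
    exact chi_mem_classFunctions μ
  · rw [finrank_span_eq_card (linearIndependent_chi n)]
    exact finrank_classFunctions_le n

/-! ### The comparison of the two families -/

theorem cycleCountProd_mem_span_chi {n m : ℕ} (hm : m ≤ n) (μ : n.Partition)
    (hμ : m ≤ firstPart μ) :
    cycleCountProd μ ∈ Submodule.span ℂ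
      (Set.range fun ν : {ν : n.Partition // m ≤ firstPart ν} => chi ν.1) := by
  obtain ⟨c, hc⟩ := (Submodule.mem_span_range_iff_exists_fun ℂ).1
    (classFunctions_le_span_chi n (cycleCountProd_mem_classFunctions μ))
  have hzero : ∀ ν : n.Partition, firstPart ν < m → c ν = 0 := by
    -- The set `ν₁ < m` is saturated: a nonzero matrix entry implies dominance, whose case `r = 1`
    -- compares first parts.
    refine coeff_eq_zero_of_triangular (fun ν => pairing n (spechtIdempotent ν)) chi
      dominanceHeight pairing_spechtIdempotent_chi_self
      eq_or_dominanceHeight_lt_of_pairing_ne_zero (fun ν => firstPart ν < m) ?_ c ?_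
    · intro ν κ hν h
      have := cellsAbove_le_of_pairing_ne_zero h 1
      rw [cellsAbove_one, cellsAbove_one] at this
      exact this.trans_lt hν
    · intro ν hν
      obtain ⟨z, hz⟩ := exists_eq_mul_rowSum_mul_colSum (spechtIdempotent_mem ν)
      simp only [hc]
      rw [hz]
      -- From `ν₁ < m ≤ μ₁` and `m ≤ n` one gets `(n - μ₁) + ν₁ < n`.
      exact pairing_mul_colSum_eq_zero (cycleCountProd_mem_localFunctions μ) ν (by omega) _
  rw [← hc]
  refine Submodule.sum_mem _ fun ν _ => ?_
  by_cases hν : m ≤ firstPart ν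
  · exact Submodule.smul_mem _ _ (Submodule.subset_span ⟨⟨ν, hν⟩, rfl⟩)
  · rw [hzero ν (not_le.1 hν), zero_smul]
    exact Submodule.zero_mem _

theorem span_cycleCountProd_eq_span_chi {n m : ℕ} (hm : m ≤ n) :
    Submodule.span ℂ
        (Set.range fun μ : {μ : n.Partition // m ≤ firstPart μ} => cycleCountProd μ.1) =
      Submodule.span ℂ (Set.range fun μ : {μ : n.Partition // m ≤ firstPart μ} => chi μ.1) := by
  refine Submodule.eq_of_le_of_finrank_eq (Submodule.span_le.2 ?_) ?_
  · rintro _ ⟨μ, rfl⟩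
    exact cycleCountProd_mem_span_chi hm μ.1 μ.2
  · exact (finrank_span_eq_card
        ((linearIndependent_cycleCountProd n).comp _ Subtype.val_injective)).trans
      (finrank_span_eq_card ((linearIndependent_chi n).comp _ Subtype.val_injective)).symm

theorem le_firstPart_adjoinPart {n k : ℕ} (hk : k ≤ n) (ν : k.Partition) :
    n - k ≤ firstPart (adjoinPart hk ν) := by
  by_cases h : n - k = 0
  · omega
  · exact le_firstPart _ (by simp [adjoinPart, h])

theorem linearIndependent_cycleCount {n k : ℕ} (hk : 2 * k ≤ n) :
    LinearIndependent ℂ fun i : Fin k => cycleCount n (i + 1) := by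
  -- For `1 ≤ j ≤ k ≤ n/2`, `(n - j, j)` is a partition whose cycle counting product is `m_j`; here
  -- `j = i + 1`.
  have hex : ∀ i : Fin k, ∃ μ : n.Partition, rows μ = [n - (i + 1), (i : ℕ) + 1] := fun i => by
    have := i.2
    refine exists_rows_eq _ ?_ ?_ ?_
    · simp
      omega
    · simp
      omega
    · simp
      omega
  choose μ hμ using hex
  have hinj : Function.Injective μ := fun i j h => by
    have h1 := hμ i
    rw [h, hμ j] at h1
    simp only [List.cons.injEq] at h1
    exact Fin.ext (by omega)
  convert (linearIndependent_cycleCountProd n).comp μ hinj using 2 with i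
  simp [cycleCountProd, hμ]

end SymChar

end

theorem proposition7p6 (n k : ℕ) (hk : k ≤ n) :
    (∀ ν : k.Partition, (∀ i ∈ ν.parts, i ≤ n - k) →
      ∃! c : {μ : n.Partition // n - k ≤ SymChar.firstPart μ} → ℂ,
        SymChar.chi (SymChar.adjoinPart hk ν) = ∑ μ, c μ • SymChar.cycleCountProd μ.1) ∧
    LinearIndependent ℂ
      (fun μ : {μ : n.Partition // n - k ≤ SymChar.firstPart μ} =>
        SymChar.cycleCountProd μ.1) ∧
    Submodule.span ℂ
        (Set.range fun μ : {μ : n.Partition // n - k ≤ SymChar.firstPart μ} =>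
          SymChar.cycleCountProd μ.1) =
      Submodule.span ℂ
        (Set.range fun μ : {μ : n.Partition // n - k ≤ SymChar.firstPart μ} =>
          SymChar.chi μ.1) ∧
    (2 * k ≤ n → LinearIndependent ℂ (fun i : Fin k => SymChar.cycleCount n (i + 1))) := by
  have hli : LinearIndependent ℂ
      (fun μ : {μ : n.Partition // n - k ≤ SymChar.firstPart μ} => SymChar.cycleCountProd μ.1) :=
    (SymChar.linearIndependent_cycleCountProd n).comp _ Subtype.val_injective
  have hspan := SymChar.span_cycleCountProd_eq_span_chi (Nat.sub_le n k)
  refine ⟨fun ν _ => ?_, hli, hspan, SymChar.linearIndependent_cycleCount⟩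
  have hmem := hspan.ge (Submodule.subset_span
    ⟨⟨SymChar.adjoinPart hk ν, SymChar.le_firstPart_adjoinPart hk ν⟩, rfl⟩)
  obtain ⟨c, hc⟩ := (Submodule.mem_span_range_iff_exists_fun ℂ).1 hmem
  refine ⟨c, hc.symm, fun d hd => ?_⟩
  exact hli.fintypeLinearCombination_injective
    (by simpa [Fintype.linearCombination_apply] using hd.symm.trans hc.symm)
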